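/- An electrical circuit with one battery is a finite connected graph (multiple edges and loops are allowed) with a positive number assigned to each edge, in which one edge, the battery, has two distinct ends marked $+$ and $-$; the other edges are the resistors. The number on the battery is its voltage $U>0$, and the number $R_e>0$ on a resistor $e$ is its resistance. Fix a direction on each edge, arbitrarily on a resistor and from $-$ to $+$ on the battery. The currents are real numbers (of any sign), $I_e$ through each resistor $e$ and $I$ through the battery, that satisfy Kirchhoff's rules: 1. at each vertex the sum of the incoming currents equals the sum of the outgoing currents; 2. along each contour the algebraic sum of the voltages $I_eR_e$ on the resistors equals the algebraic sum of the voltages of the battery each time it is traversed; a term is taken with the sign $+$ if the edge is traversed in its chosen direction, and with the sign $-$ otherwise. For a circuit drawn in the plane without crossings, the contours are the boundaries of the parts into which the circuit divides the plane, traversed counterclockwise; here a drawing is given by its combinatorial map, that is, by the counterclockwise cyclic order of the outgoing edge directions at each vertex, whose faces satisfy Euler's formula (vertices $-$ edges $+$ faces $=2$), and the contours are the boundary walks of all faces. For an arbitrary, not necessarily planar, circuit, the contours are all closed paths in the graph. The resistance of the circuit is the ratio $U/I$ of the voltage of the battery to the current through it. **Statement.** The resistance of any circuit, whether plane or arbitrary,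 whose poles are joined by a chain of resistors is positive: Kirchhoff's rules determine the currents uniquely (a solution exists and is unique), the current $I$ through the battery is nonzero, and $U/I>0$. -/

import Mathlib

/-- An electrical circuit with one battery: a connected graph (parallel edges and loops are allowed)
with vertex set `V` and edge set `E`, a positive number on every edge, and one distinguished edge,
the battery. All other edges are resistors. Every edge carries a chosen direction, from `tail` to
`head`: it is arbitrary on a resistor, while the battery is directed from the negative pole to the
positive pole. -/
structure Circuit (V E : Type*) where
  tail : E → V
  head : E → V
  battery : E
  /-- The voltage of the battery, and the resistance of a resistor. -/
  value : E → ℝ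
  value_pos : ∀ e, 0 < value e
  /-- The two poles of the battery are different. -/
  poles_ne : tail battery ≠ head battery
  connected : ∀ u v : V, Relation.EqvGen (fun x y => ∃ e, tail e = x ∧ head e = y) u v

namespace Circuit

/-- An edge together with a direction of traversal: `(e, true)` is `e` traversed in its chosen
direction, `(e, false)` is `e` traversed in the opposite direction. -/
abbrev Dart (E : Type*) := E × Bool

/-- The dart with the opposite direction of traversal. -/
def rev {E : Type*} : Equiv.Perm (Dart E) where
  toFun d := (d.1, !d.2)
  invFun d := (d.1, !d.2)
  left_inv d := by simp
  right_inv d := by simp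

/-- `+1` if the traversal agrees with the chosen direction of the edge, `-1` otherwise. -/
def sign {E : Type*} (d : Dart E) : ℝ := if d.2 then 1 else -1

variable {V E : Type*} (C : Circuit V E)

/-- The vertex from which a dart starts. -/
def source (d : Dart E) : V := if d.2 then C.tail d.1 else C.head d.1

/-- The vertex at which a dart ends. -/
def target (d : Dart E) : V := if d.2 then C.head d.1 else C.tail d.1

/-- `C.IsPath u l v`: the darts of the list `l`, in this order, form a path from `u` to `v`
(repetitions of vertices and edges are allowed). -/
def IsPath : V → List (Dart E) → V → Prop
  | u, [], v => u = v
  | u, d :: l, v => C.source d = u ∧ IsPath (C.target d) l v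

/-- The poles of the battery are joined by a chain of resistors. -/
def PolesJoined : Prop :=
  ∃ l : List (Dart E), C.IsPath (C.head C.battery) l (C.tail C.battery) ∧
    ∀ d ∈ l, d.1 ≠ C.battery

/-- Signed voltage on a traversed resistor (current times resistance) for the currents `I`;
a traversed battery contributes `0`. -/
def resistorVoltage [DecidableEq E] (I : E → ℝ) (d : Dart E) : ℝ :=
  if d.1 = C.battery then 0 else sign d * (I d.1 * C.value d.1)

/-- Signed voltage on a traversed battery; a traversed resistor contributes `0`. -/
def batteryVoltage [DecidableEq E] (d : Dart E) : ℝ :=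
  if d.1 = C.battery then sign d * C.value d.1 else 0

/-- Kirchhoff's first rule for the currents `I` (one real number for every resistor and for the
battery): at each vertex the sum of incoming currents equals the sum of outgoing currents. -/
def FirstRule [Fintype E] [DecidableEq V] (I : E → ℝ) : Prop :=
  ∀ v : V, ∑ e with C.head e = v, I e = ∑ e with C.tail e = v, I e

/-- Kirchhoff's second rule for all closed paths in the graph. -/
def ClosedPathRule [DecidableEq E] (I : E → ℝ) : Prop :=
  ∀ (v : V) (l : List (Dart E)), C.IsPath v l v →
    (l.map (C.resistorVoltage I)).sum = (l.map C.batteryVoltage).sum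

/-- A drawing of the (connected) circuit in the plane without crossings, given combinatorially by
the counterclockwise order of the darts around each vertex. -/
structure PlaneMap [Fintype V] [Fintype E] where
  /-- The next dart, in counterclockwise order, among the darts starting at the same vertex. -/
  rot : Equiv.Perm (Dart E)
  /-- The cycles of `rot` are exactly the sets of darts starting at a common vertex. -/
  sameCycle_rot : ∀ d d' : Dart E, rot.SameCycle d d' ↔ C.source d = C.source d'
  /-- Euler's formula (vertices + faces = edges + 2), which says that the surface on which the map
  is drawn is the sphere. The faces are the cycles of the permutation `rot⁻¹ * rev`. -/
  euler : Fintype.card V + Nat.card (Quotient (Equiv.Perm.SameCycle.setoid (rot⁻¹ * rev))) =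
    Fintype.card E + 2

variable {C} in
/-- The next dart on the boundary of the face lying to the left of a dart, which is traversed
counterclockwise: at the end of the dart, turn to the dart preceding the reversed dart. -/
def PlaneMap.face [Fintype V] [Fintype E] (M : C.PlaneMap) : Equiv.Perm (Dart E) :=
  M.rot⁻¹ * rev

open Classical in
/-- Kirchhoff's second rule for all contours, that is, for the boundaries of all parts into which
the circuit divides the plane; `d₀` is any dart of the contour. -/
def ContourRule [Fintype V] [Fintype E] (M : C.PlaneMap) (I : E → ℝ) : Prop :=
  ∀ d₀ : Dart E, ∑ d with M.face.SameCycle d₀ d, C.resistorVoltage I d =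
    ∑ d with M.face.SameCycle d₀ d, C.batteryVoltage d

/-- The ratio of the voltage of the battery to the current through it. -/
noncomputable def resistance (I : E → ℝ) : ℝ := C.value C.battery / I C.battery

end Circuit

open Module

namespace Circuit

/-! Count the battery as an edge with voltage `-U`. The first rule says that the currents lie in
`flows`, the orthogonal complement of the potential differences; the second says that the voltages
are a potential difference, that is, orthogonal to `flows`. So one seeks a flow `I` with `k ⬝ᵥ R I =
U * k battery` for all flows `k`. Dissipated power is positive definite on flows (`flow_eq_zero`),
which gives existence and uniqueness (`existsUnique_flow`). Taking `k = I` gives `U * I battery =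
power ≥ 0`; equality would make all currents vanish, so the poles, joined by resistors, would have
equal potentials (`battery_pos`). In the plane, Euler's formula makes the face boundaries span
`flows` (`PlaneMap.range_boundary`), so both forms of the second rule agree. -/

/-- The standard dot product on the edge space, as a bilinear form. -/
noncomputable abbrev edgeForm (E : Type*) [Fintype E] : LinearMap.BilinForm ℝ (E → ℝ) :=
  dotProductBilin ℝ ℝ

lemma edgeForm_isRefl (E : Type*) [Fintype E] : (edgeForm E).IsRefl := fun v w h => by
  simpa [dotProductBilin, dotProduct_comm] using h

lemma edgeForm_nondegenerate (E : Type*) [Fintype E] : (edgeForm E).Nondegenerate :=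
  ⟨fun v h => dotProduct_eq_zero v h,
    fun v h => dotProduct_eq_zero v fun w => by
      rw [dotProduct_comm]; exact h w⟩

/-! ### Paths, potentials and connectedness -/

section Paths

variable {V E : Type*} (C : Circuit V E)

lemma source_rev (d : Dart E) : C.source (rev d) = C.target d := by
  obtain ⟨e, _ | _⟩ := d <;> rfl

lemma IsPath.append {C : Circuit V E} {l₁ l₂ : List (Dart E)} {u v w : V}
    (h₁ : C.IsPath u l₁ v) (h₂ : C.IsPath v l₂ w) : C.IsPath u (l₁ ++ l₂) w := by
  induction l₁ generalizing u with
  | nil => cases h₁; exact h₂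
  | cons d l ih => exact ⟨h₁.1, ih h₁.2⟩

lemma isPath_singleton (d : Dart E) : C.IsPath (C.source d) [d] (C.target d) := ⟨rfl, rfl⟩

lemma exists_isPath (u v : V) : ∃ l, C.IsPath u l v := by
  -- Both directions together make the symmetric case of the induction trivial.
  suffices h : (∃ l, C.IsPath u l v) ∧ ∃ l, C.IsPath v l u from h.1
  induction C.connected u v with
  | rel x y h =>
    obtain ⟨e, rfl, rfl⟩ := h
    exact ⟨⟨_, C.isPath_singleton (e, true)⟩, ⟨_, C.isPath_singleton (e, false)⟩⟩
  | refl x => exact ⟨⟨[], rfl⟩, ⟨[], rfl⟩⟩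
  | symm x y _ ih => exact ih.symm
  | trans x y z _ _ ih₁ ih₂ =>
    obtain ⟨⟨a, ha⟩, b, hb⟩ := ih₁
    obtain ⟨⟨c, hc⟩, d, hd⟩ := ih₂
    exact ⟨⟨_, ha.append hc⟩, ⟨_, hd.append hb⟩⟩

/-- The difference of a potential on the vertices along every edge. -/
def coboundary : (V → ℝ) →ₗ[ℝ] (E → ℝ) where
  toFun φ e := φ (C.head e) - φ (C.tail e)
  map_add' φ ψ := by ext e; simp only [Pi.add_apply]; ring
  map_smul' c φ := by ext e; simp only [Pi.smul_apply, smul_eq_mul, RingHom.id_apply]; ring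

lemma coboundary_apply (φ : V → ℝ) (e : E) :
    C.coboundary φ e = φ (C.head e) - φ (C.tail e) := rfl

lemma sign_mul_coboundary (φ : V → ℝ) (d : Dart E) :
    sign d * C.coboundary φ d.1 = φ (C.target d) - φ (C.source d) := by
  obtain ⟨e, _ | _⟩ := d <;> simp [sign, coboundary_apply, target, source]

lemma IsPath.sum_coboundary {C : Circuit V E} (φ : V → ℝ) {l : List (Dart E)} {u v : V}
    (h : C.IsPath u l v) : (l.map fun d => sign d * C.coboundary φ d.1).sum = φ v - φ u := by
  induction l generalizing u with
  | nil => cases h; simp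
  | cons d l ih =>
    obtain ⟨rfl, h⟩ := h
    rw [List.map_cons, List.sum_cons, ih h, sign_mul_coboundary]
    ring

/-- A function on the edges is a potential difference if and only if its sums along all closed
paths vanish. -/
lemma mem_range_coboundary_iff (w : E → ℝ) :
    w ∈ LinearMap.range C.coboundary ↔
      ∀ (v : V) (l : List (Dart E)), C.IsPath v l v → (l.map fun d => sign d * w d.1).sum = 0 := by
  constructor
  · rintro ⟨φ, rfl⟩ v l hl
    rw [hl.sum_coboundary, sub_self]
  · intro h
    choose p hp using C.exists_isPath (C.tail C.battery)
    refine ⟨fun v => ((p v).map fun d => sign d * w d.1).sum, ?_⟩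
    ext e
    -- The same return path `q` closes both loops, so it cancels in the difference.
    obtain ⟨q, hq⟩ := C.exists_isPath (C.head e) (C.tail C.battery)
    have h₁ := h _ _ ((hp (C.head e)).append hq)
    have h₂ := h _ _ (((hp (C.tail e)).append (C.isPath_singleton (e, true))).append hq)
    simp only [List.map_append, List.sum_append, List.map_cons, List.map_nil, List.sum_cons,
      List.sum_nil] at h₁ h₂
    have hs : sign (e, true) = 1 := rfl
    rw [hs] at h₂
    rw [coboundary_apply]
    linarith

lemma eq_of_coboundary_eq_zero {φ : V → ℝ} (h : C.coboundary φ = 0) (u v : V) : φ u = φ v := by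
  induction C.connected u v with
  | rel x y hxy =>
    obtain ⟨e, rfl, rfl⟩ := hxy
    have := congrFun h e
    rw [coboundary_apply, Pi.zero_apply] at this
    linarith
  | refl x => rfl
  | symm x y _ ih => exact ih.symm
  | trans x y z _ _ ih₁ ih₂ => exact ih₁.trans ih₂

lemma finrank_range_coboundary [Fintype V] :
    finrank ℝ (LinearMap.range C.coboundary) + 1 = Fintype.card V := by
  have hker : LinearMap.ker C.coboundary = ℝ ∙ (1 : V → ℝ) := by
    ext φ
    rw [LinearMap.mem_ker, Submodule.mem_span_singleton]
    constructor
    · intro h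
      refine ⟨φ (C.tail C.battery), ?_⟩
      ext v
      simp [C.eq_of_coboundary_eq_zero h v (C.tail C.battery)]
    · rintro ⟨c, rfl⟩
      ext e
      simp [coboundary_apply]
  have : Nonempty V := ⟨C.tail C.battery⟩
  rw [← finrank_fintype_fun_eq_card ℝ (η := V), ← C.coboundary.finrank_range_add_finrank_ker,
    hker, finrank_span_singleton one_ne_zero]

end Paths

/-! ### Voltages and the second rule for closed paths -/

section Voltage

variable {V E : Type*} [DecidableEq E] (C : Circuit V E)

/-- The voltage on every edge: the product of current and resistance on a resistor, and the
negative of the voltage of the battery on the battery. -/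
def voltage (I : E → ℝ) (e : E) : ℝ :=
  if e = C.battery then -C.value e else I e * C.value e

lemma sign_mul_voltage (I : E → ℝ) (d : Dart E) :
    sign d * C.voltage I d.1 = C.resistorVoltage I d - C.batteryVoltage d := by
  unfold voltage resistorVoltage batteryVoltage
  split_ifs <;> ring

lemma closedPathRule_iff (I : E → ℝ) :
    C.ClosedPathRule I ↔ C.voltage I ∈ LinearMap.range C.coboundary := by
  rw [mem_range_coboundary_iff]
  refine forall_congr' fun v => forall_congr' fun l => imp_congr_right fun h => ?_
  clear h
  simp only [sign_mul_voltage]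
  rw [← sub_eq_zero]
  refine Eq.congr ?_ rfl
  induction l with
  | nil => simp
  | cons d l ih => simp only [List.map_cons, List.sum_cons, ← ih]; ring

/-- The product of current and resistance on every resistor, and zero on the battery, as a linear
function of the currents. -/
def resistorMap : (E → ℝ) →ₗ[ℝ] (E → ℝ) where
  toFun I e := if e = C.battery then 0 else I e * C.value e
  map_add' I J := by ext e; simp only [Pi.add_apply]; split_ifs <;> ring
  map_smul' c I := by
    ext e; simp only [Pi.smul_apply, smul_eq_mul, RingHom.id_apply]; split_ifs <;> ring

lemma resistorMap_apply (I : E → ℝ) (e : E) :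
    C.resistorMap I e = if e = C.battery then 0 else I e * C.value e := rfl

lemma voltage_eq (I : E → ℝ) :
    C.voltage I = C.resistorMap I - Pi.single C.battery (C.value C.battery) := by
  ext e
  by_cases he : e = C.battery
  · subst he; simp [voltage, resistorMap_apply]
  · simp [voltage, resistorMap_apply, he]

lemma mul_resistorMap_nonneg (I : E → ℝ) (e : E) : 0 ≤ I e * C.resistorMap I e := by
  rw [resistorMap_apply]
  split_ifs
  · simp
  · rw [← mul_assoc]; exact mul_nonneg (mul_self_nonneg _) (C.value_pos e).le

end Voltage

/-! ### Flows, orthogonality and dissipated power -/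

section Kirchhoff

variable {V E : Type*} [Fintype E] (C : Circuit V E)

/-- The flows, orthogonal to all potential differences. -/
noncomputable def flows : Submodule ℝ (E → ℝ) :=
  (edgeForm E).orthogonal (LinearMap.range C.coboundary)

lemma mem_flows_iff (I : E → ℝ) : I ∈ C.flows ↔ ∀ φ : V → ℝ, C.coboundary φ ⬝ᵥ I = 0 := by
  refine ⟨fun h φ => h _ ⟨φ, rfl⟩, fun h => ?_⟩
  rintro _ ⟨φ, rfl⟩
  exact h φ

/-- In finite dimension a subspace is its own double orthogonal complement. -/
lemma mem_range_coboundary_iff_flows (w : E → ℝ) :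
    w ∈ LinearMap.range C.coboundary ↔ ∀ k ∈ C.flows, k ⬝ᵥ w = 0 := by
  have h := LinearMap.BilinForm.orthogonal_orthogonal (edgeForm_nondegenerate E)
    (edgeForm_isRefl E) (LinearMap.range C.coboundary)
  exact ⟨fun hw => by rw [← h] at hw; exact hw, fun hw => by rw [← h]; exact hw⟩

lemma coboundary_dotProduct [Fintype V] [DecidableEq V] (φ : V → ℝ) (I : E → ℝ) :
    C.coboundary φ ⬝ᵥ I =
      ∑ v, φ v * (∑ e with C.head e = v, I e - ∑ e with C.tail e = v, I e) := by
  simp only [mul_sub, Finset.sum_sub_distrib, Finset.mul_sum]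
  have key (g : E → V) : ∑ v, ∑ e with g e = v, φ v * I e = ∑ e, φ (g e) * I e := by
    rw [← Finset.sum_fiberwise Finset.univ g]
    refine Finset.sum_congr rfl fun v _ => Finset.sum_congr rfl fun e he => ?_
    rw [(Finset.mem_filter.1 he).2]
  rw [key, key, ← Finset.sum_sub_distrib]
  exact Finset.sum_congr rfl fun e _ => by rw [coboundary_apply, sub_mul]

lemma firstRule_iff_mem_flows [Fintype V] [DecidableEq V] (I : E → ℝ) :
    C.FirstRule I ↔ I ∈ C.flows := by
  rw [mem_flows_iff]
  constructor
  · intro h φ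
    rw [coboundary_dotProduct]
    exact Finset.sum_eq_zero fun v _ => by rw [h v, sub_self, mul_zero]
  · intro h v
    have := h (Pi.single v 1)
    rw [coboundary_dotProduct, Finset.sum_eq_single v] at this
    · simpa [sub_eq_zero] using this
    · intro u _ hu
      rw [Pi.single_eq_of_ne hu, zero_mul]
    · simp

variable [DecidableEq E]

lemma dotProduct_voltage (k I : E → ℝ) :
    k ⬝ᵥ C.voltage I = k ⬝ᵥ C.resistorMap I - k C.battery * C.value C.battery := by
  rw [voltage_eq, dotProduct_sub, dotProduct_single]

lemma dotProduct_resistorMap_nonneg (I : E → ℝ) : 0 ≤ I ⬝ᵥ C.resistorMap I :=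
  Finset.sum_nonneg fun e _ => C.mul_resistorMap_nonneg I e

/-- If no power is dissipated, then there are no currents through the resistors. -/
lemma eq_zero_of_dotProduct_resistorMap {I : E → ℝ} (h : I ⬝ᵥ C.resistorMap I = 0) {e : E}
    (he : e ≠ C.battery) : I e = 0 := by
  have := (Finset.sum_eq_zero_iff_of_nonneg fun e _ => C.mul_resistorMap_nonneg I e).1 h e
    (Finset.mem_univ e)
  rw [resistorMap_apply, if_neg he] at this
  simpa [(C.value_pos e).ne'] using this

lemma flow_eq_zero {I : E → ℝ} (hI : I ∈ C.flows) (h : I ⬝ᵥ C.resistorMap I = 0) : I = 0 := by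
  classical
  have hR := fun e he => C.eq_zero_of_dotProduct_resistorMap h (e := e) he
  -- Conservation at the positive pole: only the battery can still carry current, and it is not a
  -- loop.
  have hb := (C.mem_flows_iff I).1 hI (Pi.single (C.head C.battery) 1)
  unfold dotProduct at hb
  rw [Finset.sum_eq_single C.battery (fun e _ he => by rw [hR e he, mul_zero]) (by simp),
    coboundary_apply, Pi.single_eq_same, Pi.single_eq_of_ne C.poles_ne, sub_zero, one_mul] at hb
  ext e
  by_cases he : e = C.battery
  · rw [he, hb, Pi.zero_apply]
  · exact hR e he

lemma existsUnique_flow :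
    ∃! I : E → ℝ, I ∈ C.flows ∧ C.voltage I ∈ LinearMap.range C.coboundary := by
  let A : C.flows →ₗ[ℝ] Dual ℝ C.flows :=
    (edgeForm E).compl₁₂ (C.resistorMap ∘ₗ C.flows.subtype) C.flows.subtype
  have hA (I k : C.flows) : A I k = (k : E → ℝ) ⬝ᵥ C.resistorMap I := dotProduct_comm _ _
  have hinj : Function.Injective A := by
    rw [← LinearMap.ker_eq_bot, LinearMap.ker_eq_bot']
    intro I hI
    exact Subtype.ext (C.flow_eq_zero I.2 (by rw [← hA, hI, LinearMap.zero_apply]))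
  -- `A` is the power form; injectivity suffices because a space and its dual have equal dimension.
  have hsurj : Function.Surjective A :=
    (LinearMap.injective_iff_surjective_of_finrank_eq_finrank
      (Subspace.dual_finrank_eq (K := ℝ) (V := C.flows)).symm).1 hinj
  have hiff (I : E → ℝ) : C.voltage I ∈ LinearMap.range C.coboundary ↔
      ∀ k ∈ C.flows, k ⬝ᵥ C.resistorMap I = k C.battery * C.value C.battery := by
    simp only [mem_range_coboundary_iff_flows, dotProduct_voltage, sub_eq_zero]
  simp only [hiff]
  obtain ⟨I, hI⟩ := hsurj
    ((C.value C.battery • LinearMap.proj (R := ℝ) (φ := fun _ => ℝ) C.battery) ∘ₗ C.flows.subtype)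
  refine ⟨I, ⟨I.2, fun k hk => ?_⟩, ?_⟩
  · rw [← hA I ⟨k, hk⟩, hI]
    simp [mul_comm]
  · rintro J ⟨hJ, hJ'⟩
    have : (⟨J, hJ⟩ : C.flows) = I := hinj <| by
      ext k
      rw [hA, hI, hJ' k k.2]
      simp [mul_comm]
    rw [← this]

lemma battery_pos (hC : C.PolesJoined) {I : E → ℝ} (hI : I ∈ C.flows)
    (hw : C.voltage I ∈ LinearMap.range C.coboundary) : 0 < I C.battery := by
  have hP := (C.mem_range_coboundary_iff_flows _).1 hw I hI
  rw [dotProduct_voltage, sub_eq_zero] at hP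
  have hU := C.value_pos C.battery
  have h0 : 0 ≤ I C.battery :=
    nonneg_of_mul_nonneg_left (hP ▸ C.dotProduct_resistorMap_nonneg I) hU
  refine lt_of_le_of_ne h0 fun hz => ?_
  rw [← hz, zero_mul] at hP
  have hI0 := C.flow_eq_zero hI hP
  obtain ⟨φ, hφ⟩ := hw
  obtain ⟨l, hl, hlb⟩ := hC
  have hsum := hl.sum_coboundary φ
  rw [List.sum_eq_zero, eq_comm, sub_eq_zero] at hsum
  · have := congrFun hφ C.battery
    rw [coboundary_apply, hsum, sub_self, voltage, if_pos rfl] at this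
    linarith
  · intro x hx
    obtain ⟨d, hd, rfl⟩ := List.mem_map.1 hx
    rw [hφ, voltage, if_neg (hlb d hd), hI0]
    simp

end Kirchhoff

/-! ### Plane maps and face boundaries -/

section Plane

variable {V E : Type*} [Fintype V] [Fintype E] {C : Circuit V E} (M : C.PlaneMap)

/-- The faces of a plane map. -/
abbrev PlaneMap.Face : Type _ := Quotient (Equiv.Perm.SameCycle.setoid M.face)

/-- The face to the left of a dart. -/
def PlaneMap.left (d : Dart E) : M.Face := Quotient.mk _ d

lemma PlaneMap.left_eq_left_iff (d d' : Dart E) :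
    M.left d = M.left d' ↔ M.face.SameCycle d d' := Quotient.eq

lemma PlaneMap.left_face (d : Dart E) : M.left (M.face d) = M.left d :=
  (M.left_eq_left_iff _ _).2 (Equiv.Perm.sameCycle_apply_left.2 (Equiv.Perm.SameCycle.refl _ _))

lemma PlaneMap.source_face (d : Dart E) : C.source (M.face d) = C.target d := by
  rw [← C.source_rev, ← M.sameCycle_rot]
  exact Equiv.Perm.sameCycle_symm_apply_left.2 (Equiv.Perm.SameCycle.refl _ _)

lemma sum_sign_mul (f : Dart E → ℝ) (w : E → ℝ) :
    ∑ d : Dart E, f d * (sign d * w d.1) = ∑ e, (f (e, true) - f (e, false)) * w e := by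
  rw [Fintype.sum_prod_type]
  refine Finset.sum_congr rfl fun e _ => ?_
  rw [Fintype.sum_bool]
  simp only [sign, if_true, Bool.false_eq_true, if_false]
  ring

/-- The boundary of a combination of faces. -/
def PlaneMap.boundary : (M.Face → ℝ) →ₗ[ℝ] (E → ℝ) where
  toFun f e := f (M.left (e, true)) - f (M.left (e, false))
  map_add' f g := by ext e; simp only [Pi.add_apply]; ring
  map_smul' c f := by ext e; simp only [Pi.smul_apply, smul_eq_mul, RingHom.id_apply]; ring

lemma PlaneMap.boundary_apply (f : M.Face → ℝ) (e : E) :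
    M.boundary f e = f (M.left (e, true)) - f (M.left (e, false)) := rfl

lemma PlaneMap.boundary_dotProduct (f : M.Face → ℝ) (w : E → ℝ) :
    M.boundary f ⬝ᵥ w = ∑ d : Dart E, f (M.left d) * (sign d * w d.1) :=
  (sum_sign_mul (fun d => f (M.left d)) w).symm

/-- `M.face` permutes the darts, keeps the face on the left and sends a dart to one starting at its
target, so the target and source sums agree. -/
lemma PlaneMap.boundary_mem_flows (f : M.Face → ℝ) : M.boundary f ∈ C.flows := by
  rw [mem_flows_iff]
  intro φ
  rw [dotProduct_comm, M.boundary_dotProduct]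
  simp only [sign_mul_coboundary, mul_sub, Finset.sum_sub_distrib]
  rw [sub_eq_zero, ← Equiv.sum_comp M.face fun d => f (M.left d) * φ (C.source d)]
  simp only [M.left_face, M.source_face]

/-- `f` agrees on the two sides of each edge, hence on all faces around a vertex, hence everywhere
by connectedness. -/
lemma PlaneMap.eq_of_boundary_eq_zero {f : M.Face → ℝ} (h : M.boundary f = 0) (a b : M.Face) :
    f a = f b := by
  have hrev (d : Dart E) : f (M.left (rev d)) = f (M.left d) := by
    have h' (e : E) : f (M.left (e, true)) = f (M.left (e, false)) :=
      sub_eq_zero.1 (congrFun h e)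
    obtain ⟨e, _ | _⟩ := d
    exacts [h' e, (h' e).symm]
  have hrot (d : Dart E) : f (M.left (M.rot d)) = f (M.left d) := by
    have : M.face (rev (M.rot d)) = d := by
      change M.rot⁻¹ (rev (rev (M.rot d))) = d
      have hr : rev (rev (M.rot d)) = M.rot d := by simp [rev]
      rw [hr]
      exact M.rot.symm_apply_apply d
    rw [← hrev, ← M.left_face, this]
  have hsource {d d' : Dart E} (hd : C.source d = C.source d') : f (M.left d) = f (M.left d') := by
    obtain ⟨n, rfl⟩ := ((M.sameCycle_rot d d').2 hd).exists_nat_pow_eq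
    induction n with
    | zero => rfl
    | succ n ih =>
      rw [pow_succ', Equiv.Perm.mul_apply, hrot]
      refine ih ?_
      rw [← M.sameCycle_rot]
      exact (Equiv.Perm.sameCycle_pow_right).2 (Equiv.Perm.SameCycle.refl _ _)
  have hconst (c : ℝ) (u v : V) : (∀ d, C.source d = u → f (M.left d) = c) ↔
      ∀ d, C.source d = v → f (M.left d) = c := by
    induction C.connected u v with
    | rel x y hxy =>
      obtain ⟨e, rfl, rfl⟩ := hxy
      have := hrev (e, true)
      constructor
      · intro hx d hd
        rw [hsource (show C.source d = C.source (rev (e, true)) from hd), this]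
        exact hx _ rfl
      · intro hy d hd
        rw [hsource (show C.source d = C.source (e, true) from hd), ← this]
        exact hy _ rfl
    | refl x => rfl
    | symm x y _ ih => exact ih.symm
    | trans x y z _ _ ih₁ ih₂ => exact ih₁.trans ih₂
  obtain ⟨d, rfl⟩ := Quotient.exists_rep a
  obtain ⟨d', rfl⟩ := Quotient.exists_rep b
  exact ((hconst _ (C.source d') (C.source d)).1 (fun d'' hd => hsource hd) d rfl)

lemma PlaneMap.finrank_range_boundary :
    finrank ℝ (LinearMap.range M.boundary) + 1 = Nat.card M.Face := by
  classical
  have : Fintype M.Face := Fintype.ofFinite _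
  let a : M.Face := M.left (C.battery, true)
  have hker : LinearMap.ker M.boundary = ℝ ∙ (1 : M.Face → ℝ) := by
    ext f
    rw [LinearMap.mem_ker, Submodule.mem_span_singleton]
    constructor
    · intro h
      refine ⟨f a, ?_⟩
      ext b
      simp [M.eq_of_boundary_eq_zero h b a]
    · rintro ⟨c, rfl⟩
      ext e
      simp [PlaneMap.boundary_apply]
  have : Nonempty M.Face := ⟨a⟩
  rw [Nat.card_eq_fintype_card, ← finrank_fintype_fun_eq_card ℝ (η := M.Face),
    ← M.boundary.finrank_range_add_finrank_ker, hker, finrank_span_singleton one_ne_zero]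

/-- On the sphere, every flow is a combination of boundaries of faces. -/
lemma PlaneMap.range_boundary : LinearMap.range M.boundary = C.flows := by
  refine Submodule.eq_of_le_of_finrank_le ?_ ?_
  · rintro _ ⟨f, rfl⟩
    exact M.boundary_mem_flows f
  · rw [flows, LinearMap.BilinForm.finrank_orthogonal (edgeForm_nondegenerate E),
      finrank_fintype_fun_eq_card]
    -- Euler's formula in the form `E - (V - 1) = F - 1`.
    have h₁ := C.finrank_range_coboundary
    have h₂ := M.finrank_range_boundary
    have h₃ : Fintype.card V + Nat.card M.Face = Fintype.card E + 2 := M.euler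
    omega

lemma contourRule_iff [DecidableEq E] (I : E → ℝ) :
    C.ContourRule M I ↔ C.voltage I ∈ LinearMap.range C.coboundary := by
  classical
  have hrule : C.ContourRule M I ↔
      ∀ d₀, ∑ d with M.left d = M.left d₀, sign d * C.voltage I d.1 = 0 := by
    refine forall_congr' fun d₀ => ?_
    simp only [sign_mul_voltage, Finset.sum_sub_distrib, sub_eq_zero, PlaneMap.left_eq_left_iff,
      Equiv.Perm.sameCycle_comm (y := d₀)]
    convert Iff.rfl
  rw [hrule, mem_range_coboundary_iff_flows, ← M.range_boundary]
  constructor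
  · rintro h _ ⟨f, rfl⟩
    have : Fintype M.Face := Fintype.ofFinite _
    rw [M.boundary_dotProduct, ← Finset.sum_fiberwise Finset.univ M.left]
    refine Finset.sum_eq_zero fun q _ => ?_
    obtain ⟨d₀, rfl⟩ := Quotient.exists_rep q
    rw [← mul_zero (f (M.left d₀)), ← h d₀, Finset.mul_sum]
    refine Finset.sum_congr rfl fun d hd => ?_
    rw [(Finset.mem_filter.1 hd).2]
  · intro h d₀
    -- The boundary of a single face recovers its contour sum.
    have := h _ ⟨Pi.single (M.left d₀) 1, rfl⟩
    rw [M.boundary_dotProduct] at this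
    simpa [Pi.single_apply, ite_mul, Finset.sum_filter] using this

end Plane

end Circuit

theorem mainTheorem7 {V E : Type*} [Fintype V] [Fintype E] [DecidableEq V] [DecidableEq E]
    (C : Circuit V E) (hC : C.PolesJoined) :
    -- plane circuits, with the second rule for the boundaries of the faces
    (∀ M : C.PlaneMap,
      (∃! I : E → ℝ, C.FirstRule I ∧ C.ContourRule M I) ∧
      ∀ I : E → ℝ, C.FirstRule I → C.ContourRule M I →
        I C.battery ≠ 0 ∧ 0 < C.resistance I) ∧
    -- arbitrary circuits, with the second rule for all closed paths
    ((∃! I : E → ℝ, C.FirstRule I ∧ C.ClosedPathRule I) ∧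
      ∀ I : E → ℝ, C.FirstRule I → C.ClosedPathRule I →
        I C.battery ≠ 0 ∧ 0 < C.resistance I) := by
  have hpos : ∀ I : E → ℝ, C.FirstRule I → C.voltage I ∈ LinearMap.range C.coboundary →
      I C.battery ≠ 0 ∧ 0 < C.resistance I := fun I h₁ h₂ =>
    have h := C.battery_pos hC ((C.firstRule_iff_mem_flows I).1 h₁) h₂
    ⟨h.ne', div_pos (C.value_pos _) h⟩
  have hex : ∃! I : E → ℝ, C.FirstRule I ∧ C.voltage I ∈ LinearMap.range C.coboundary := by
    simpa only [Circuit.firstRule_iff_mem_flows] using C.existsUnique_flow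
  refine ⟨fun M => ?_, ?_⟩
  · simp only [Circuit.contourRule_iff]
    exact ⟨hex, hpos⟩
  · simp only [Circuit.closedPathRule_iff]
    exact ⟨hex, hpos⟩
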